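/- Let $G$ be a locally compact, second countable, Hausdorff topological group. For $i=1,2$ let $\mathcal R_i=(U_i,\mathsf E_i,\mathcal H_i)$ be a principal frame: $\mathcal H_i$ is a complex separable Hilbert space, $U_i$ is a strongly continuous unitary representation of $G$ on $\mathcal H_i$, $\Sigma_i$ is a principal homogeneous (left) $G$-space, i.e. for every $x\in\Sigma_i$ the orbit map $g\mapsto g.x$ is a homeomorphism $G\to\Sigma_i$, and $\mathsf E_i:\mathcal B(\Sigma_i)\to B(\mathcal H_i)$ is a POVM with $\mathsf E_i(g.X)=U_i(g)\mathsf E_i(X)U_i(g)^*$. Assume that both frames are localizable: $\|\mathsf E_i(X)\|=1$ for every Borel set $X$ with $\mathsf E_i(X)\neq 0$. Fix points $x_i\in\Sigma_i$, identify $\Sigma_i$ with $G$ through $g\mapsto g.x_i$ (so that $x_i$ corresponds to the identity $e$), and regard $\mathsf E_i$ as a POVM on $G$ accordingly (for $\Sigma_i=G$ and $x_i=e$ nothing changes). For a POVM $\mathsf E$ and a state (positive trace class operator of trace one) $\omega$ write $\mu^{\mathsf E}_\omega(X)=\mathrm{tr}[\omega\,\mathsf E(X)]$. Let $(\omega_n)$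 and $(\rho_m)$ be localizing sequences for $\mathsf E_1$ and $\mathsf E_2$ centred at $e$, i.e. sequences of states on $\mathcal H_1$ and on $\mathcal H_2$ such that $\mu^{\mathsf E_1}_{\omega_n}\to\delta_e$ and $\mu^{\mathsf E_2}_{\rho_m}\to\delta_e$ weakly. The relative orientation observable is $$(\mathsf E_2*\mathsf E_1)(X)=\int_G d\mathsf E_1(g)\otimes U_2(g)\,\mathsf E_2(X)\,U_2(g)^*\in B(\mathcal H_1\otimes\mathcal H_2),\qquad X\in\mathcal B(G),$$ where for $A\in B(\mathcal H_2)$ the integral $\int_G d\mathsf E_1(g)\otimes U_2(g)AU_2(g)^*$ is the bounded operator whose expectation value in each product vector $\varphi\otimes\psi$ is $\int_G\langle\psi,U_2(g)AU_2(g)^*\psi\rangle\,d\langle\varphi,\mathsf E_1(g)\varphi\rangle$. For $h\in G$ put $h.\rho=U_2(h)^*\rho\,U_2(h)$ and $\Omega_{n,m}(h)=\omega_n\otimes h^{-1}.\rho_m$. Then for every $h\in G$ and all $n,m$ the set function $X\mapsto\mathrm{tr}[\Omega_{n,m}(h)\,(\mathsf E_2*\mathsf E_1)(X)]$ is a Borel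 probability measure $\mu^{\mathsf E_2*\mathsf E_1}_{\Omega_{n,m}(h)}$ on $G$, and, weakly, $$\lim_{n,m\to\infty}\mu^{\mathsf E_2*\mathsf E_1}_{\Omega_{n,m}(h)}=\delta_h .$$ -/

import Mathlib

open MeasureTheory Filter Topology
open scoped TensorProduct InnerProductSpace

noncomputable section

set_option linter.unusedSectionVars false

namespace QRF

/-- The Hilbert space tensor product: the completion of the algebraic tensor product with respect
to the inner product `⟪x ⊗ y, x' ⊗ y'⟫ = ⟪x, x'⟫ ⟪y, y'⟫`. -/
abbrev HilbertTensor (H K : Type*) [NormedAddCommGroup H] [InnerProductSpace ℂ H]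
    [NormedAddCommGroup K] [InnerProductSpace ℂ K] : Type _ :=
  UniformSpace.Completion (H ⊗[ℂ] K)

section Basics

variable {H : Type*} [NormedAddCommGroup H] [InnerProductSpace ℂ H]
variable {K : Type*} [NormedAddCommGroup K] [InnerProductSpace ℂ K]

/-- The product vector `φ ⊗ ψ` in the Hilbert space tensor product. -/
def tmul (φ : H) (ψ : K) : HilbertTensor H K :=
  ((φ ⊗ₜ[ℂ] ψ : H ⊗[ℂ] K) : UniformSpace.Completion (H ⊗[ℂ] K))

/-- The bounded operator `A ⊗ B` on the Hilbert space tensor product. -/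
def opTensor (A : H →L[ℂ] H) (B : K →L[ℂ] K) :
    HilbertTensor H K →L[ℂ] HilbertTensor H K :=
  (TensorProduct.mapL A B).completion

/-- The index set of a fixed orthonormal basis of `H`. -/
def basisIndex (H : Type*) [NormedAddCommGroup H] [InnerProductSpace ℂ H] [CompleteSpace H] :
    Set H :=
  (exists_hilbertBasis ℂ H).choose

/-- A fixed orthonormal basis of `H`. -/
def basis (H : Type*) [NormedAddCommGroup H] [InnerProductSpace ℂ H] [CompleteSpace H] :
    HilbertBasis (basisIndex H) ℂ H :=
  (exists_hilbertBasis ℂ H).choose_spec.choose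

/-- The trace `tr[T] = ∑ᵢ ⟪eᵢ, T eᵢ⟫`. For trace class `T` the series converges absolutely and
does not depend on the orthonormal basis. -/
def trace [CompleteSpace H] (T : H →L[ℂ] H) : ℂ :=
  ∑' i, ⟪basis H i, T (basis H i)⟫_ℂ

variable (H) in
/-- A (normal) state: a positive trace class operator of trace one. For a positive operator the
terms of the trace are nonnegative, so `trace op = 1` already forces their summability, that is,
that `op` is trace class. -/
structure State [CompleteSpace H] where
  op : H →L[ℂ] H
  isPositive : op.IsPositive
  trace_eq_one : trace op = 1

end Basics

/-- A positive operator valued measure on the measurable sets of `S`, with values in `B(H)`;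
the values of `toFun` on non-measurable sets are irrelevant. -/
structure POVM (S : Type*) [MeasurableSpace S] (H : Type*) [NormedAddCommGroup H]
    [InnerProductSpace ℂ H] where
  toFun : Set S → H →L[ℂ] H
  isPositive : ∀ X, MeasurableSet X → (toFun X).IsPositive
  map_univ : toFun Set.univ = 1
  hasSum_iUnion : ∀ X : ℕ → Set S, (∀ i, MeasurableSet (X i)) →
    Pairwise (Function.onFun Disjoint X) → ∀ φ ψ : H,
      HasSum (fun i => ⟪φ, toFun (X i) ψ⟫_ℂ) ⟪φ, toFun (⋃ i, X i) ψ⟫_ℂ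

namespace POVM

variable {S : Type*} [MeasurableSpace S] {S' : Type*} [MeasurableSpace S']
variable {H : Type*} [NormedAddCommGroup H] [InnerProductSpace ℂ H]

theorem map_empty_inner (E : POVM S H) (φ ψ : H) : ⟪φ, E.toFun ∅ ψ⟫_ℂ = 0 := by
  have h := E.hasSum_iUnion (fun _ => ∅) (fun _ => MeasurableSet.empty)
    (fun _ _ _ => disjoint_bot_left) φ ψ
  exact tendsto_nhds_unique tendsto_const_nhds h.summable.tendsto_atTop_zero

theorem re_nonneg (E : POVM S H) {X : Set S} (hX : MeasurableSet X) (φ : H) :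
    0 ≤ (⟪φ, E.toFun X φ⟫_ℂ).re :=
  (E.isPositive X hX).re_inner_nonneg_right φ

/-- The finite positive measure `X ↦ ⟪φ, E(X) φ⟫`. -/
def vectorMeasure (E : POVM S H) (φ : H) : Measure S :=
  Measure.ofMeasurable (fun X _ => ENNReal.ofReal (⟪φ, E.toFun X φ⟫_ℂ).re)
    (by simp [E.map_empty_inner φ φ])
    (by
      intro X hX hd
      have h := Complex.hasSum_re (E.hasSum_iUnion X hX hd φ φ)
      rw [← h.tsum_eq, ENNReal.ofReal_tsum_of_nonneg (fun i => E.re_nonneg (hX i) φ) h.summable])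

theorem vectorMeasure_apply (E : POVM S H) (φ : H) {X : Set S} (hX : MeasurableSet X) :
    E.vectorMeasure φ X = ENNReal.ofReal (⟪φ, E.toFun X φ⟫_ℂ).re :=
  Measure.ofMeasurable_apply X hX

/-- The norm-1 property. -/
def IsLocalizable (E : POVM S H) : Prop :=
  ∀ X, MeasurableSet X → E.toFun X ≠ 0 → ‖E.toFun X‖ = 1

/-- The image of a POVM under a measurable map. -/
def map (E : POVM S H) (f : S → S') (hf : Measurable f) : POVM S' H where
  toFun Y := E.toFun (f ⁻¹' Y)
  isPositive Y hY := E.isPositive _ (hf hY)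
  map_univ := by simpa using E.map_univ
  hasSum_iUnion Y hY hd φ ψ := by
    have h := E.hasSum_iUnion (fun i => f ⁻¹' (Y i)) (fun i => hf (hY i))
      (fun i j hij => (hd hij).preimage f) φ ψ
    simpa [Set.preimage_iUnion] using h

end POVM

section Born

variable {S : Type*} [MeasurableSpace S]
variable {H : Type*} [NormedAddCommGroup H] [InnerProductSpace ℂ H] [CompleteSpace H]

/-- `μ` is the probability measure that the operator valued set function `E` and the density
operator `ω` give through the Born rule: `μ(X) = tr[ω E(X)]` for all measurable `X`. -/
def IsBornMeasure (E : Set S → H →L[ℂ] H) (ω : H →L[ℂ] H) (μ : ProbabilityMeasure S) : Prop :=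
  ∀ X, MeasurableSet X → ((((μ : Measure S) X).toReal : ℝ) : ℂ) = trace (ω ∘L E X)

/-- A localizing sequence of `E` centred at `x`: a sequence of states `ω n` whose Born measures
converge weakly to the Dirac measure at `x`. -/
def IsLocalizingSequence [TopologicalSpace S] [OpensMeasurableSpace S]
    (E : POVM S H) (x : S) (ω : ℕ → State H) : Prop :=
  ∃ μ : ℕ → ProbabilityMeasure S,
    (∀ n, IsBornMeasure E.toFun (ω n).op (μ n)) ∧ Tendsto μ atTop (𝓝 (diracProba x))

end Born

section Representations

/-- A strongly continuous unitary representation of `G` on `H`. -/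
structure UnitaryRep (G : Type*) [Group G] [TopologicalSpace G]
    (H : Type*) [NormedAddCommGroup H] [InnerProductSpace ℂ H] [CompleteSpace H] where
  toHom : G →* unitary (H →L[ℂ] H)
  strongly_continuous : ∀ φ : H, Continuous fun g => (toHom g : H →L[ℂ] H) φ

variable {G : Type*} [Group G] [TopologicalSpace G]
variable {H : Type*} [NormedAddCommGroup H] [InnerProductSpace ℂ H] [CompleteSpace H]

/-- The operator `U(g)`. -/
def UnitaryRep.op (U : UnitaryRep G H) (g : G) : H →L[ℂ] H := (U.toHom g : H →L[ℂ] H)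

/-- The action on observables: `g.A = U(g) A U(g)*`. -/
def UnitaryRep.actObs (U : UnitaryRep G H) (g : G) (A : H →L[ℂ] H) : H →L[ℂ] H :=
  U.op g ∘L A ∘L (U.op g).adjoint

/-- The action on trace class operators: `g.T = U(g)* T U(g)`. -/
def UnitaryRep.actState (U : UnitaryRep G H) (g : G) (T : H →L[ℂ] H) : H →L[ℂ] H :=
  (U.op g).adjoint ∘L T ∘L U.op g

end Representations

/-- A quantum reference frame on a homogeneous `G`-space `S`: a system of covariance `(U, E, H)`
based on `S`. -/
structure Frame (G : Type*) [Group G] [TopologicalSpace G]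
    (S : Type*) [TopologicalSpace S] [MeasurableSpace S] [MulAction G S]
    [ContinuousSMul G S] [MulAction.IsPretransitive G S]
    (H : Type*) [NormedAddCommGroup H] [InnerProductSpace ℂ H] [CompleteSpace H] where
  U : UnitaryRep G H
  E : POVM S H
  covariant : ∀ (g : G) (X : Set S), MeasurableSet X →
    E.toFun ((fun s => g • s) '' X) = U.actObs g (E.toFun X)

/-- `S` is a principal homogeneous `G`-space: for every base point `x` the orbit map `g ↦ g • x`
is a homeomorphism from `G` onto `S`. -/
def IsPrincipalSpace (G : Type*) [Group G] [TopologicalSpace G]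
    (S : Type*) [TopologicalSpace S] [MulAction G S] : Prop :=
  ∀ x : S, IsHomeomorph (fun g : G => g • x)

section FrameOnGroup

variable {G : Type*} [Group G] [TopologicalSpace G] [IsTopologicalGroup G]
  [MeasurableSpace G] [BorelSpace G]
variable {S : Type*} [TopologicalSpace S] [MeasurableSpace S] [BorelSpace S] [MulAction G S]
  [ContinuousSMul G S] [MulAction.IsPretransitive G S]
variable {H : Type*} [NormedAddCommGroup H] [InnerProductSpace ℂ H] [CompleteSpace H]

/-- The identification of a principal homogeneous space with `G` that sends the base point `x`
to the identity `e`, that is, the inverse of `g ↦ g • x`. -/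
def toGroup (hS : IsPrincipalSpace G S) (x : S) : S ≃ₜ G := ((hS x).homeomorph _).symm

theorem toGroup_smul (hS : IsPrincipalSpace G S) (x : S) (g : G) (s : S) :
    toGroup hS x (g • s) = g * toGroup hS x s := by
  apply (hS x).injective
  have key : ∀ t : S, (toGroup hS x t) • x = t := fun t =>
    ((hS x).homeomorph _).apply_symm_apply t
  simp only [key, mul_smul]

theorem toGroup_preimage_image (hS : IsPrincipalSpace G S) (x : S) (g : G) (Y : Set G) :
    (toGroup hS x) ⁻¹' ((fun k => g • k) '' Y) =
      (fun s => g • s) '' ((toGroup hS x) ⁻¹' Y) := by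
  ext s
  simp only [Set.mem_preimage, Set.mem_image, smul_eq_mul]
  constructor
  · rintro ⟨k, hk, hks⟩
    refine ⟨g⁻¹ • s, ?_, smul_inv_smul g s⟩
    rw [toGroup_smul, ← hks]
    simpa using hk
  · rintro ⟨t, ht, rfl⟩
    exact ⟨_, ht, (toGroup_smul hS x g t).symm⟩

/-- A frame on a principal homogeneous space, regarded as a frame on `G` by means of the
identification `g ↦ g • x`. -/
def Frame.onGroup (R : Frame G S H) (hS : IsPrincipalSpace G S) (x : S) : Frame G G H where
  U := R.U
  E := R.E.map (toGroup hS x) (toGroup hS x).measurable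
  covariant g Y hY := by
    change R.E.toFun ((toGroup hS x) ⁻¹' ((fun k => g • k) '' Y)) =
      R.U.actObs g (R.E.toFun ((toGroup hS x) ⁻¹' Y))
    rw [toGroup_preimage_image]
    exact R.covariant g _ ((toGroup hS x).measurable hY)

end FrameOnGroup

section Relativization

variable {G : Type*} [Group G] [TopologicalSpace G] [IsTopologicalGroup G]
  [MeasurableSpace G]
variable {H : Type*} [NormedAddCommGroup H] [InnerProductSpace ℂ H] [CompleteSpace H]
variable {K : Type*} [NormedAddCommGroup K] [InnerProductSpace ℂ K] [CompleteSpace K]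

/-- `T` is the weak operator integral `∫_G dE(g) ⊗ U(g) A U(g)*`: its expectation value in every
product vector `φ ⊗ ψ` is `∫_G ⟪ψ, U(g) A U(g)* ψ⟫ d⟪φ, E(g) φ⟫`. By polarization, and since the
product vectors span a dense subspace, at most one bounded operator `T` has this property. -/
def IsRelativization (E : POVM G H) (U : UnitaryRep G K) (A : K →L[ℂ] K)
    (T : HilbertTensor H K →L[ℂ] HilbertTensor H K) : Prop :=
  ∀ (φ : H) (ψ : K), ⟪tmul φ ψ, T (tmul φ ψ)⟫_ℂ =
    ∫ g, ⟪ψ, U.actObs g A ψ⟫_ℂ ∂(E.vectorMeasure φ)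

theorem tmul_add_left (φ φ' : H) (ψ : K) : tmul (φ + φ') ψ = tmul φ ψ + tmul φ' ψ := by
  simp only [tmul, TensorProduct.add_tmul]
  exact UniformSpace.Completion.coe_add _ _

theorem tmul_add_right (φ : H) (ψ ψ' : K) : tmul φ (ψ + ψ') = tmul φ ψ + tmul φ ψ' := by
  simp only [tmul, TensorProduct.tmul_add]
  exact UniformSpace.Completion.coe_add _ _

theorem tmul_smul_left (c : ℂ) (φ : H) (ψ : K) : tmul (c • φ) ψ = c • tmul φ ψ := by
  simp only [tmul, ← TensorProduct.smul_tmul']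
  exact UniformSpace.Completion.coe_smul _ _

theorem tmul_smul_right (c : ℂ) (φ : H) (ψ : K) : tmul φ (c • ψ) = c • tmul φ ψ := by
  simp only [tmul, TensorProduct.tmul_smul]
  exact UniformSpace.Completion.coe_smul _ _

theorem eq_zero_of_inner_tmul (D : HilbertTensor H K →L[ℂ] HilbertTensor H K)
    (hD : ∀ (φ : H) (ψ : K), ⟪tmul φ ψ, D (tmul φ ψ)⟫_ℂ = 0) : D = 0 := by
  have h1 : ∀ (φ φ' : H) (ψ : K), ⟪tmul φ ψ, D (tmul φ' ψ)⟫_ℂ = 0 := by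
    intro φ φ' ψ
    have a := hD (φ + φ') ψ
    have b := hD (φ + Complex.I • φ') ψ
    simp only [tmul_add_left, tmul_smul_left, map_add, map_smul, inner_add_left, inner_add_right,
      inner_smul_left, inner_smul_right, hD, Complex.conj_I] at a b
    have hI := Complex.I_mul_I
    linear_combination (1 / 2 : ℂ) * a - (Complex.I / 2) * b +
      (1 / 2 : ℂ) * (⟪tmul φ ψ, D (tmul φ' ψ)⟫_ℂ - ⟪tmul φ' ψ, D (tmul φ ψ)⟫_ℂ) * hI
  have h2 : ∀ (φ φ' : H) (ψ ψ' : K), ⟪tmul φ ψ, D (tmul φ' ψ')⟫_ℂ = 0 := by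
    intro φ φ' ψ ψ'
    have a := h1 φ φ' (ψ + ψ')
    have b := h1 φ φ' (ψ + Complex.I • ψ')
    simp only [tmul_add_right, tmul_smul_right, map_add, map_smul, inner_add_left,
      inner_add_right, inner_smul_left, inner_smul_right, h1, Complex.conj_I] at a b
    have hI := Complex.I_mul_I
    linear_combination (1 / 2 : ℂ) * a - (Complex.I / 2) * b +
      (1 / 2 : ℂ) * (⟪tmul φ ψ, D (tmul φ' ψ')⟫_ℂ - ⟪tmul φ ψ', D (tmul φ' ψ)⟫_ℂ) * hI
  have h3 : ∀ (φ : H) (ψ : K) (v : HilbertTensor H K), ⟪v, D (tmul φ ψ)⟫_ℂ = 0 := by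
    intro φ ψ v
    induction v using UniformSpace.Completion.induction_on with
    | hp => exact isClosed_eq (by fun_prop) continuous_const
    | ih t =>
      induction t using TensorProduct.induction_on with
      | zero => rw [UniformSpace.Completion.coe_zero, inner_zero_left]
      | tmul a b => exact h2 a φ b ψ
      | add x y hx hy =>
        rw [UniformSpace.Completion.coe_add, inner_add_left, hx, hy, add_zero]
  have h4 : ∀ (φ : H) (ψ : K), D (tmul φ ψ) = 0 := fun φ ψ => inner_self_eq_zero.mp (h3 φ ψ _)
  ext v
  induction v using UniformSpace.Completion.induction_on with
  | hp => exact isClosed_eq (by fun_prop) (by fun_prop)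
  | ih t =>
    induction t using TensorProduct.induction_on with
    | zero => rw [UniformSpace.Completion.coe_zero, map_zero, map_zero]
    | tmul a b => exact h4 a b
    | add x y hx hy => rw [UniformSpace.Completion.coe_add, map_add, map_add, hx, hy]

theorem IsRelativization.unique {E : POVM G H} {U : UnitaryRep G K} {A : K →L[ℂ] K}
    {T T' : HilbertTensor H K →L[ℂ] HilbertTensor H K}
    (hT : IsRelativization E U A T) (hT' : IsRelativization E U A T') : T = T' := by
  refine sub_eq_zero.mp (eq_zero_of_inner_tmul _ fun φ ψ => ?_)
  rw [sub_apply, inner_sub_right, hT φ ψ, hT' φ ψ, sub_self]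

open Classical in
/-- The relativization map of the frame `R`, `A ↦ ∫_G dE_R(g) ⊗ U(g) A U(g)*`. -/
def relativization (R : Frame G G H) (U : UnitaryRep G K) (A : K →L[ℂ] K) :
    HilbertTensor H K →L[ℂ] HilbertTensor H K :=
  if h : ∃ T, IsRelativization R.E U A T then h.choose else 0

/-- The observable `E₂ * E₁` of relative orientation of `R₂` with respect to `R₁`: the composition
of the relativization map of `R₁` with the frame observable of `R₂`. -/
def relativeOrientation (R₁ : Frame G G H) (R₂ : Frame G G K) (X : Set G) :
    HilbertTensor H K →L[ℂ] HilbertTensor H K :=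
  relativization R₁ R₂.U (R₂.E.toFun X)

end Relativization

end QRF

end

/-! In the vector `φ ⊗ U₂(h)ψ`, covariance of `E₂` turns the expectation of `(E₂ * E₁)(X)` into `∫
⟨ψ, E₂(h⁻¹gX)ψ⟩ d⟨φ, E₁(g)φ⟩`, the mass that the product of the two vector measures gives to `{(g,
k) | g⁻¹hk ∈ X}` (`inner_relativeOrientation`). Writing states as mixtures of vectors extends this
to states: the Born measure in `Ω_{n,m}(h)` is the image of `μ_n × ν_m` under `(g, k) ↦ g⁻¹hk`
(`isBornMeasure_relativeOrientation`). Products preserve weak convergence and the map is continuous,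
so the limit is the Dirac measure at `e⁻¹he = h`.

Since `relativization` defaults to zero, the operator integral must be shown to exist
(`exists_isRelativization`): integrals over simple functions have norm at most one, and a weak
operator limit of them works. -/

namespace QRF

/-! ### Product vectors and product operators. -/

section Tensor

variable {H : Type*} [NormedAddCommGroup H] [InnerProductSpace ℂ H]
variable {K : Type*} [NormedAddCommGroup K] [InnerProductSpace ℂ K]

theorem inner_tmul_tmul (φ φ' : H) (ψ ψ' : K) :
    ⟪tmul φ ψ, tmul φ' ψ'⟫_ℂ = ⟪φ, φ'⟫_ℂ * ⟪ψ, ψ'⟫_ℂ := by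
  simp [tmul, UniformSpace.Completion.inner_coe]

theorem norm_tmul (φ : H) (ψ : K) : ‖tmul φ ψ‖ = ‖φ‖ * ‖ψ‖ := by
  simp [tmul, UniformSpace.Completion.norm_coe]

theorem opTensor_tmul (A : H →L[ℂ] H) (B : K →L[ℂ] K) (φ : H) (ψ : K) :
    opTensor A B (tmul φ ψ) = tmul (A φ) (B ψ) := by
  simp only [opTensor, tmul]
  rw [ContinuousLinearMap.completion_apply_coe]
  simp

variable [CompleteSpace H] [CompleteSpace K]

theorem ext_inner_tmul {S T : HilbertTensor H K →L[ℂ] HilbertTensor H K}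
    (h : ∀ (φ : H) (ψ : K), ⟪tmul φ ψ, S (tmul φ ψ)⟫_ℂ = ⟪tmul φ ψ, T (tmul φ ψ)⟫_ℂ) :
    S = T := by
  refine sub_eq_zero.mp (eq_zero_of_inner_tmul _ fun φ ψ => ?_)
  rw [sub_apply, inner_sub_right, h, sub_self]

/-- A positive operator has a symmetric square root. -/
theorem exists_sqrt {A : H →L[ℂ] H} (hA : A.IsPositive) :
    ∃ a : H →L[ℂ] H, ∀ φ ψ, ⟪a φ, a ψ⟫_ℂ = ⟪φ, A ψ⟫_ℂ ∧ ⟪a φ, ψ⟫_ℂ = ⟪φ, a ψ⟫_ℂ := by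
  have hA' : 0 ≤ A := (ContinuousLinearMap.nonneg_iff_isPositive A).mpr hA
  have hs : (CFC.sqrt A).IsPositive :=
    (ContinuousLinearMap.nonneg_iff_isPositive _).mp (CFC.sqrt_nonneg A)
  refine ⟨CFC.sqrt A, fun φ ψ => ⟨?_, hs.inner_left_eq_inner_right φ ψ⟩⟩
  rw [hs.inner_left_eq_inner_right φ, ← mul_apply_eq_comp,
    CFC.sqrt_mul_sqrt_self A hA']

/-- With symmetric roots `a`, `b`, the operator `A ⊗ B` equals `(a ⊗ b)* (a ⊗ b)`; product vectors
suffice to check this. -/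
theorem isPositive_opTensor {A : H →L[ℂ] H} {B : K →L[ℂ] K} (hA : A.IsPositive)
    (hB : B.IsPositive) : (opTensor A B).IsPositive := by
  obtain ⟨a, ha⟩ := exists_sqrt hA
  obtain ⟨b, hb⟩ := exists_sqrt hB
  have : opTensor A B = (opTensor a b).adjoint ∘L opTensor a b :=
    ext_inner_tmul fun φ ψ => by
      rw [ContinuousLinearMap.comp_apply, ContinuousLinearMap.adjoint_inner_right]
      simp only [opTensor_tmul, inner_tmul_tmul, (ha _ _).1, (hb _ _).1]
  rw [this]
  exact ContinuousLinearMap.isPositive_adjoint_comp_self _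

end Tensor

/-! ### States as mixtures of vectors, and the trace against them. -/

section Ensemble

open InnerProductSpace (rankOne)

variable {H : Type*} [NormedAddCommGroup H] [InnerProductSpace ℂ H] [CompleteSpace H]
variable {K : Type*} [NormedAddCommGroup K] [InnerProductSpace ℂ K] [CompleteSpace K]
variable {ι κ : Type*}

/-- `A` is the mixture `∑ᵢ |vᵢ⟩⟨vᵢ|` of a square summable family of vectors. -/
structure IsEnsemble (A : H →L[ℂ] H) (v : ι → H) : Prop where
  summable : Summable fun i => ‖v i‖ ^ 2
  hasSum : HasSum (fun i => rankOne ℂ (v i) (v i)) A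

theorem summable_rankOne {v : ι → H} (hv : Summable fun i => ‖v i‖ ^ 2) :
    Summable fun i => rankOne ℂ (v i) (v i) := by
  refine Summable.of_norm ?_
  simpa [← sq] using hv

theorem hasSum_inner_of_hasSum_rankOne {v : ι → H} {A : H →L[ℂ] H}
    (h : HasSum (fun i => rankOne ℂ (v i) (v i)) A) (x y : H) :
    HasSum (fun i => ⟪x, v i⟫_ℂ * ⟪v i, y⟫_ℂ) ⟪x, A y⟫_ℂ := by
  have h1 := (h.mapL (ContinuousLinearMap.apply ℂ H y)).mapL (innerSL ℂ x)
  simpa [inner_smul_right, mul_comm] using h1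

/-- Square summability makes the rank one series converge in norm; its sum has the same quadratic
form as `A`, and over `ℂ` the quadratic form determines the operator. -/
theorem isEnsemble_of_hasSum_inner {A : H →L[ℂ] H} {v : ι → H}
    (hv : Summable fun i => ‖v i‖ ^ 2)
    (h : ∀ φ, HasSum (fun i => ⟪φ, v i⟫_ℂ * ⟪v i, φ⟫_ℂ) ⟪φ, A φ⟫_ℂ) : IsEnsemble A v := by
  refine ⟨hv, ?_⟩
  have hs := (summable_rankOne hv).hasSum
  convert hs
  refine ContinuousLinearMap.coe_injective ((ext_inner_map _ _).mp fun φ => ?_)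
  have := (h φ).unique (hasSum_inner_of_hasSum_rankOne hs φ φ)
  rw [← inner_conj_symm, ← inner_conj_symm _ φ]
  exact congrArg _ this

theorem exists_isEnsemble {v : ι → H} (hv : Summable fun i => ‖v i‖ ^ 2) :
    ∃ A : H →L[ℂ] H, IsEnsemble A v :=
  ⟨_, hv, (summable_rankOne hv).hasSum⟩

theorem IsEnsemble.hasSum_inner {v : ι → H} {A : H →L[ℂ] H} (hA : IsEnsemble A v) (x y : H) :
    HasSum (fun i => ⟪x, v i⟫_ℂ * ⟪v i, y⟫_ℂ) ⟪x, A y⟫_ℂ :=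
  hasSum_inner_of_hasSum_rankOne hA.hasSum x y

theorem isEnsemble_opTensor {A : H →L[ℂ] H} {B : K →L[ℂ] K} {v : ι → H} {w : κ → K}
    (hA : IsEnsemble A v) (hB : IsEnsemble B w) :
    IsEnsemble (opTensor A B) (fun p : ι × κ => tmul (v p.1) (w p.2)) := by
  have hv : Summable fun p : ι × κ => ‖tmul (v p.1) (w p.2)‖ ^ 2 := by
    simp only [norm_tmul, mul_pow]
    exact hA.summable.mul_of_nonneg hB.summable (fun _ => sq_nonneg _) (fun _ => sq_nonneg _)
  obtain ⟨D, hD⟩ := exists_isEnsemble hv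
  have key : opTensor A B = D := by
    refine ext_inner_tmul fun φ ψ => ?_
    have h1 := hA.hasSum_inner φ φ
    have h2 := hB.hasSum_inner ψ ψ
    have hn := summable_mul_of_summable_norm (f := fun i => ⟪φ, v i⟫_ℂ * ⟪v i, φ⟫_ℂ)
      (g := fun j => ⟪ψ, w j⟫_ℂ * ⟪w j, ψ⟫_ℂ) h1.summable.norm h2.summable.norm
    have h3 := h1.mul h2 hn
    have h4 := hD.hasSum_inner (tmul φ ψ) (tmul φ ψ)
    rw [opTensor_tmul, inner_tmul_tmul]
    refine h3.unique (h4.congr_fun fun p => ?_)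
    simp only [inner_tmul_tmul]
    ring
  rwa [key]

theorem IsEnsemble.conj {A : H →L[ℂ] H} {v : ι → H} (hA : IsEnsemble A v) (V : H →L[ℂ] H) :
    IsEnsemble (V ∘L A ∘L V.adjoint) (fun i => V (v i)) := by
  refine isEnsemble_of_hasSum_inner ?_ fun φ => ?_
  · refine Summable.of_nonneg_of_le (fun _ => sq_nonneg _) (fun i => ?_)
      (hA.summable.mul_left (‖V‖ ^ 2))
    rw [← mul_pow]
    gcongr
    exact V.le_opNorm _
  · have := hA.hasSum_inner (V.adjoint φ) (V.adjoint φ)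
    simpa only [ContinuousLinearMap.adjoint_inner_left, ContinuousLinearMap.adjoint_inner_right,
      ContinuousLinearMap.comp_apply] using this

/-- The vectors are `√ω eᵢ`: their squared norms add up to the trace, and Parseval for `√ω φ` gives
the quadratic form. No spectral theorem is needed, as the vectors of a mixture need not be
orthogonal. -/
theorem State.exists_isEnsemble (ω : State H) :
    ∃ v : basisIndex H → H, IsEnsemble ω.op v := by
  obtain ⟨a, ha⟩ := exists_sqrt ω.isPositive
  refine ⟨fun i => a (basis H i), isEnsemble_of_hasSum_inner ?_ fun φ => ?_⟩
  · have hs : Summable fun i => ⟪basis H i, ω.op (basis H i)⟫_ℂ := by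
      -- A divergent `tsum` is `0` by convention, contradicting trace one.
      by_contra h
      have := ω.trace_eq_one
      rw [trace, tsum_eq_zero_of_not_summable h] at this
      exact zero_ne_one this
    convert (Complex.hasSum_re hs.hasSum).summable using 2 with i
    rw [← (ha _ _).1, inner_self_eq_norm_sq_to_K]
    norm_cast
  · have h := (basis H).hasSum_inner_mul_inner (a φ) (a φ)
    rw [(ha φ φ).1] at h
    exact h.congr_fun fun i => by rw [(ha φ (basis H i)).2, (ha (basis H i) φ).2]

/-- The trace against a mixture, computed in the vectors of the mixture. -/
theorem IsEnsemble.hasSum_trace {A : H →L[ℂ] H} {v : ι → H} (hA : IsEnsemble A v)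
    (T : H →L[ℂ] H) : HasSum (fun i => ⟪v i, T (v i)⟫_ℂ) (trace (A ∘L T)) := by
  set b := basis H
  set F : ι × basisIndex H → ℂ := fun p => ⟪T.adjoint (v p.1), b p.2⟫_ℂ * ⟪b p.2, v p.1⟫_ℂ
  have parseval : ∀ x : H, HasSum (fun j => ‖⟪b j, x⟫_ℂ‖ ^ 2) (‖x‖ ^ 2) := by
    intro x
    have h := Complex.hasSum_re (b.hasSum_inner_mul_inner x x)
    rw [inner_self_eq_norm_sq_to_K] at h
    convert h using 2 with j
    · rw [← inner_conj_symm x, ← Complex.normSq_eq_conj_mul_self, Complex.normSq_eq_norm_sq,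
        Complex.ofReal_re]
    · norm_cast
  have sq_summable : ∀ u : ι → H, Summable (fun i => ‖u i‖ ^ 2) →
      Summable fun p : ι × basisIndex H => ‖⟪b p.2, u p.1⟫_ℂ‖ ^ 2 := by
    intro u hu
    refine (summable_prod_of_nonneg fun _ => sq_nonneg _).mpr
      ⟨fun i => (parseval (u i)).summable, ?_⟩
    simpa only [(parseval (u _)).tsum_eq] using hu
  have hT : Summable fun i => ‖T.adjoint (v i)‖ ^ 2 := by
    refine Summable.of_nonneg_of_le (fun _ => sq_nonneg _) (fun i => ?_)
      (hA.summable.mul_left (‖T.adjoint‖ ^ 2))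
    rw [← mul_pow]
    gcongr
    exact T.adjoint.le_opNorm _
  have hF : Summable F := by
    -- A product is at most the sum of the squares of its factors; both square families are summable
    -- by Parseval.
    refine Summable.of_norm_bounded ((sq_summable _ hT).add (sq_summable _ hA.summable))
      fun p => ?_
    rw [norm_mul, norm_inner_symm]
    nlinarith [sq_nonneg (‖⟪b p.2, T.adjoint (v p.1)⟫_ℂ‖ - ‖⟪b p.2, v p.1⟫_ℂ‖),
      sq_nonneg ‖⟪b p.2, T.adjoint (v p.1)⟫_ℂ‖, sq_nonneg ‖⟪b p.2, v p.1⟫_ℂ‖]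
  have h1 : ∀ i, HasSum (fun j => F (i, j)) ⟪v i, T (v i)⟫_ℂ := fun i => by
    have h := b.hasSum_inner_mul_inner (T.adjoint (v i)) (v i)
    rwa [ContinuousLinearMap.adjoint_inner_left] at h
  have h2 : ∀ j, HasSum (fun i => F (i, j)) ⟪b j, (A ∘L T) (b j)⟫_ℂ := fun j =>
    (hA.hasSum_inner (b j) (T (b j))).congr_fun fun i => by
      simp only [F, ContinuousLinearMap.adjoint_inner_left]
      ring
  have h3 : HasSum (fun j => ⟪b j, (A ∘L T) (b j)⟫_ℂ) (∑' p, F p) :=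
    ((Equiv.prodComm _ _).hasSum_iff.mpr hF.hasSum).prod_fiberwise h2
  rw [trace, h3.tsum_eq]
  exact hF.hasSum.prod_fiberwise h1

end Ensemble

/-! ### Weak operator compactness. -/

section WeakLimit

variable {H : Type*} [NormedAddCommGroup H] [InnerProductSpace ℂ H] [CompleteSpace H]

/-- Bounded sets of operators are relatively compact in the weak operator topology. -/
theorem exists_weak_limit {T : ℕ → H →L[ℂ] H} {C : ℝ} (hT : ∀ n, ‖T n‖ ≤ C) (l : Ultrafilter ℕ) :
    ∃ S : H →L[ℂ] H, ∀ x y, Tendsto (fun n => ⟪x, T n y⟫_ℂ) l (𝓝 ⟪x, S y⟫_ℂ) := by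
  have bound : ∀ x y n, ‖⟪x, T n y⟫_ℂ‖ ≤ C * ‖x‖ * ‖y‖ := fun x y n => by
    have h1 := norm_inner_le_norm (𝕜 := ℂ) x (T n y)
    have h2 := (T n).le_of_opNorm_le (hT n) y
    nlinarith [norm_nonneg x]
  have hlim : ∀ x y, ∃ z, Tendsto (fun n => ⟪x, T n y⟫_ℂ) l (𝓝 z) := fun x y => by
    obtain ⟨z, -, hz⟩ := (isCompact_closedBall (0 : ℂ) (C * ‖x‖ * ‖y‖)).ultrafilter_le_nhds
      (l.map fun n => ⟪x, T n y⟫_ℂ)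
      (le_principal_iff.mpr (Filter.mem_map.mpr (Eventually.of_forall fun n => by simpa using bound x y n)))
    exact ⟨z, hz⟩
  choose B hB using hlim
  let L : H →ₗ⋆[ℂ] H →ₗ[ℂ] ℂ := LinearMap.mk₂'ₛₗ _ _ B
    (fun x x' y => tendsto_nhds_unique (hB _ _)
      (by simpa only [inner_add_left] using (hB x y).add (hB x' y)))
    (fun c x y => tendsto_nhds_unique (hB _ _)
      (by simpa only [inner_smul_left, smul_eq_mul] using (hB x y).const_mul _))
    (fun x y y' => tendsto_nhds_unique (hB _ _)
      (by simpa only [map_add, inner_add_right] using (hB x y).add (hB x y')))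
    (fun c x y => tendsto_nhds_unique (hB _ _)
      (by simpa only [map_smul, inner_smul_right, smul_eq_mul, RingHom.id_apply] using (hB x y).const_mul c))
  have hL : ∀ x y, ‖L x y‖ ≤ C * ‖x‖ * ‖y‖ := fun x y =>
    le_of_tendsto (hB x y).norm (Eventually.of_forall fun n => bound x y n)
  -- The represented operator sits in the first slot of the inner product; the adjoint moves it to
  -- the second.
  refine ⟨(InnerProductSpace.continuousLinearMapOfBilin (L.mkContinuous₂ C hL)).adjoint,
    fun x y => ?_⟩
  rw [ContinuousLinearMap.adjoint_inner_right,
    InnerProductSpace.continuousLinearMapOfBilin_apply]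
  exact hB x y

end WeakLimit

/-! ### Vector measures and complements of effects. -/

section VectorMeasure

variable {S : Type*} [MeasurableSpace S]
variable {H : Type*} [NormedAddCommGroup H] [InnerProductSpace ℂ H]

theorem POVM.inner_eq_ofReal (E : POVM S H) {X : Set S} (hX : MeasurableSet X) (φ : H) :
    ⟪φ, E.toFun X φ⟫_ℂ = ((E.vectorMeasure φ).real X : ℂ) := by
  rw [Measure.real, E.vectorMeasure_apply φ hX, ENNReal.toReal_ofReal (E.re_nonneg hX φ)]
  exact (Complex.eq_re_of_ofReal_le ((E.isPositive X hX).inner_nonneg_right φ))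

instance (E : POVM S H) (φ : H) : IsFiniteMeasure (E.vectorMeasure φ) :=
  ⟨by rw [E.vectorMeasure_apply φ MeasurableSet.univ]; exact ENNReal.ofReal_lt_top⟩

theorem POVM.isPositive_one_sub [CompleteSpace H] (E : POVM S H) {X : Set S}
    (hX : MeasurableSet X) : (1 - E.toFun X).IsPositive := by
  convert E.isPositive Xᶜ hX.compl
  refine ContinuousLinearMap.coe_injective ((ext_inner_map _ _).mp fun φ => ?_)
  have h : ⟪φ, (1 - E.toFun X) φ⟫_ℂ = ⟪φ, E.toFun Xᶜ φ⟫_ℂ := by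
    have hu := E.inner_eq_ofReal MeasurableSet.univ φ
    rw [E.map_univ, ← measureReal_add_measureReal_compl hX, Complex.ofReal_add,
      ← E.inner_eq_ofReal hX, ← E.inner_eq_ofReal hX.compl] at hu
    rw [sub_apply, inner_sub_right, hu]
    ring
  rw [← inner_conj_symm, ← inner_conj_symm _ φ]
  exact congrArg _ h

end VectorMeasure

/-! ### Operator integrals over simple functions. -/

section SimpleIntegral

variable {S : Type*} [MeasurableSpace S]
variable {H : Type*} [NormedAddCommGroup H] [InnerProductSpace ℂ H] [CompleteSpace H]
variable {K : Type*} [NormedAddCommGroup K] [InnerProductSpace ℂ K] [CompleteSpace K]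

/-- The operator integral `∫ dE(g) ⊗ F(s(g))` of a function of a simple function `s`. -/
noncomputable def simpleIntegral (E : POVM S H) {α : Type*} (s : SimpleFunc S α)
    (F : α → K →L[ℂ] K) : HilbertTensor H K →L[ℂ] HilbertTensor H K :=
  ∑ y ∈ s.range, opTensor (E.toFun (s ⁻¹' {y})) (F y)

theorem inner_simpleIntegral (E : POVM S H) {α : Type*} (s : SimpleFunc S α)
    (F : α → K →L[ℂ] K) (φ : H) (ψ : K) :
    ⟪tmul φ ψ, simpleIntegral E s F (tmul φ ψ)⟫_ℂ =
      ∫ g, ⟪ψ, F (s g) ψ⟫_ℂ ∂(E.vectorMeasure φ) := by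
  have h : ∀ g, ⟪ψ, F (s g) ψ⟫_ℂ =
      ∑ y ∈ s.range, (s ⁻¹' {y}).indicator (fun _ => ⟪ψ, F y ψ⟫_ℂ) g := fun g => by
    rw [Finset.sum_eq_single (s g)]
    · simp
    · intro y _ hy
      exact Set.indicator_of_notMem (fun hg => hy hg.symm) _
    · intro hg
      exact absurd (s.mem_range_self g) hg
  simp_rw [h]
  rw [integral_finsetSum _ fun y _ => (integrable_const _).indicator (s.measurableSet_fiber y),
    simpleIntegral, sum_apply, inner_sum]
  refine Finset.sum_congr rfl fun y _ => ?_
  rw [integral_indicator_const _ (s.measurableSet_fiber y), opTensor_tmul, inner_tmul_tmul,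
    E.inner_eq_ofReal (s.measurableSet_fiber y), Complex.real_smul]

theorem isPositive_simpleIntegral (E : POVM S H) {α : Type*} (s : SimpleFunc S α)
    {F : α → K →L[ℂ] K} (hF : ∀ y, (F y).IsPositive) : (simpleIntegral E s F).IsPositive :=
  ContinuousLinearMap.isPositive_sum _ fun y _ =>
    isPositive_opTensor (E.isPositive _ (s.measurableSet_fiber y)) (hF y)

/-- As `E` has total mass `1`, the integral of `1 - F` is `1` minus that of `F`; positivity of both
puts the integral between `0` and `1`. The bound does not depend on `s`, as weak compactness
requires. -/
theorem norm_simpleIntegral_le (E : POVM S H) {α : Type*} (s : SimpleFunc S α)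
    {F : α → K →L[ℂ] K} (hF : ∀ y, (F y).IsPositive) (hF' : ∀ y, (1 - F y).IsPositive)
    (hint : ∀ φ ψ, Integrable (fun g => ⟪ψ, F (s g) ψ⟫_ℂ) (E.vectorMeasure φ)) :
    ‖simpleIntegral E s F‖ ≤ 1 := by
  have key : 1 - simpleIntegral E s F = simpleIntegral E s fun y => 1 - F y :=
    ext_inner_tmul fun φ ψ => by
      rw [sub_apply, inner_sub_right, inner_simpleIntegral, inner_simpleIntegral]
      simp only [sub_apply, inner_sub_right]
      rw [integral_sub (integrable_const _) (hint φ ψ), integral_const]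
      simp only [one_apply_eq_self, inner_tmul_tmul, Complex.real_smul]
      rw [← E.inner_eq_ofReal MeasurableSet.univ, E.map_univ, one_apply_eq_self]
  have h0 : 0 ≤ simpleIntegral E s F :=
    (ContinuousLinearMap.nonneg_iff_isPositive _).mpr (isPositive_simpleIntegral E s hF)
  have h1 : simpleIntegral E s F ≤ 1 := by
    rw [ContinuousLinearMap.le_def, key]
    exact isPositive_simpleIntegral E s hF'
  exact (CStarAlgebra.norm_le_norm_of_nonneg_of_le h0 h1).trans
    ContinuousLinearMap.norm_id_le

end SimpleIntegral

/-! ### Existence of the relativization. -/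

section Existence

variable {G : Type*} [Group G] [TopologicalSpace G]
variable {H : Type*} [NormedAddCommGroup H] [InnerProductSpace ℂ H] [CompleteSpace H]
variable {K : Type*} [NormedAddCommGroup K] [InnerProductSpace ℂ K] [CompleteSpace K]

theorem UnitaryRep.adjoint_op (U : UnitaryRep G K) (g : G) : (U.op g).adjoint = U.op g⁻¹ := by
  rw [UnitaryRep.op, UnitaryRep.op, map_inv, ← ContinuousLinearMap.star_eq_adjoint]
  rfl

theorem UnitaryRep.op_mul (U : UnitaryRep G K) (g k : G) : U.op (g * k) = U.op g ∘L U.op k := by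
  simp only [UnitaryRep.op, map_mul]
  rfl

theorem UnitaryRep.op_one (U : UnitaryRep G K) : U.op 1 = 1 := by
  simp [UnitaryRep.op]

theorem UnitaryRep.actObs_one (U : UnitaryRep G K) (g : G) : U.actObs g 1 = 1 := by
  rw [UnitaryRep.actObs, UnitaryRep.adjoint_op]
  change U.op g ∘L U.op g⁻¹ = 1
  rw [← U.op_mul, mul_inv_cancel, U.op_one]

theorem UnitaryRep.actObs_sub (U : UnitaryRep G K) (g : G) (A B : K →L[ℂ] K) :
    U.actObs g (A - B) = U.actObs g A - U.actObs g B := by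
  ext x
  simp [UnitaryRep.actObs]

theorem UnitaryRep.inner_actObs (U : UnitaryRep G K) (g : G) (A : K →L[ℂ] K) (x y : K) :
    ⟪x, U.actObs g A y⟫_ℂ = ⟪U.op g⁻¹ x, A (U.op g⁻¹ y)⟫_ℂ := by
  rw [UnitaryRep.actObs, ← U.adjoint_op]
  simp [ContinuousLinearMap.adjoint_inner_left]

theorem UnitaryRep.norm_actObs (U : UnitaryRep G K) (g : G) (A : K →L[ℂ] K) :
    ‖U.actObs g A‖ = ‖A‖ := by
  rw [UnitaryRep.actObs, U.adjoint_op]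
  exact (CStarRing.norm_coe_unitary_mul (U.toHom g) _).trans
    (CStarRing.norm_mul_coe_unitary A (U.toHom g⁻¹))

variable [IsTopologicalGroup G]

theorem UnitaryRep.continuous_inner_actObs (U : UnitaryRep G K) (A : K →L[ℂ] K) (x y : K) :
    Continuous fun g => ⟪x, U.actObs g A y⟫_ℂ := by
  simp only [U.inner_actObs]
  have h : ∀ z, Continuous fun g : G => U.op g⁻¹ z := fun z =>
    (U.strongly_continuous z).comp continuous_inv
  exact (h x).inner (A.continuous.comp (h y))

variable [SecondCountableTopology G] [MeasurableSpace G] [BorelSpace G]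

/-- The weak operator integral `∫ dE(g) ⊗ U(g) A U(g)*` of an effect `A` exists. -/
theorem exists_isRelativization (E : POVM G H) (U : UnitaryRep G K) {A : K →L[ℂ] K}
    (hA : A.IsPositive) (hA' : (1 - A).IsPositive) : ∃ T, IsRelativization E U A T := by
  -- A pseudometric is chosen so that the identity of `G` is a pointwise limit of simple functions.
  let _ := TopologicalSpace.pseudoMetrizableSpacePseudoMetric G
  let s : ℕ → SimpleFunc G G :=
    SimpleFunc.approxOn id measurable_id Set.univ 1 (Set.mem_univ _)
  have hs : ∀ g, Tendsto (fun n => s n g) atTop (𝓝 g) := fun g =>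
    SimpleFunc.tendsto_approxOn measurable_id (Set.mem_univ _) (by simp)
  have hpos : ∀ {B : K →L[ℂ] K}, B.IsPositive → ∀ g, (U.actObs g B).IsPositive :=
    fun hB g => hB.conj_adjoint (U.op g)
  have hmeas : ∀ n ψ, Measurable fun g => ⟪ψ, U.actObs (s n g) A ψ⟫_ℂ := fun n ψ =>
    (U.continuous_inner_actObs A ψ ψ).measurable.comp (s n).measurable
  have hbound : ∀ g ψ, ‖⟪ψ, U.actObs g A ψ⟫_ℂ‖ ≤ ‖ψ‖ * (‖A‖ * ‖ψ‖) := fun g ψ =>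
    (norm_inner_le_norm _ _).trans (by
      gcongr
      exact (U.actObs g A).le_of_opNorm_le (U.norm_actObs g A |>.le) ψ)
  have hnorm : ∀ n, ‖simpleIntegral E (s n) fun g => U.actObs g A‖ ≤ 1 := fun n => by
    refine norm_simpleIntegral_le E (s n) (hpos hA) (fun g => ?_) fun φ ψ => ?_
    · rw [← U.actObs_one g, ← U.actObs_sub]
      exact hpos hA' g
    · exact Integrable.of_bound (hmeas n ψ).aestronglyMeasurable _
        (Eventually.of_forall fun g => hbound _ ψ)
  obtain ⟨T, hT⟩ := exists_weak_limit hnorm (Ultrafilter.of atTop)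
  refine ⟨T, fun φ ψ => tendsto_nhds_unique (hT _ _) ?_⟩
  simp only [inner_simpleIntegral]
  -- The ultrafilter refines `atTop`, so ordinary dominated convergence identifies the limit; strong
  -- continuity of `U` gives pointwise convergence.
  refine Tendsto.mono_left ?_ (Ultrafilter.of_le _)
  exact tendsto_integral_of_dominated_convergence (fun _ => ‖ψ‖ * (‖A‖ * ‖ψ‖))
    (fun n => (hmeas n ψ).aestronglyMeasurable) (integrable_const _)
    (fun n => Eventually.of_forall fun g => hbound _ ψ)
    (Eventually.of_forall fun g =>
      ((U.continuous_inner_actObs A ψ ψ).tendsto g).comp (hs g))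

theorem isRelativization_relativization (R : Frame G G H) (U : UnitaryRep G K) {A : K →L[ℂ] K}
    (hA : A.IsPositive) (hA' : (1 - A).IsPositive) :
    IsRelativization R.E U A (relativization R U A) := by
  have h := exists_isRelativization R.E U hA hA'
  rw [relativization, dif_pos h]
  exact h.choose_spec

end Existence

/-! ### Born measures as sums of vector measures. -/

section Born

variable {H : Type*} [NormedAddCommGroup H] [InnerProductSpace ℂ H] [CompleteSpace H]
variable {ι : Type*}

theorem IsEnsemble.restrict_support {A : H →L[ℂ] H} {v : ι → H} (hA : IsEnsemble A v) :
    IsEnsemble A (fun i : Function.support v => v i) where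
  summable := hA.summable.comp_injective Subtype.val_injective
  hasSum := (hasSum_subtype_iff_of_support_subset fun i hi => by
    contrapose! hi
    simp_all).mpr hA.hasSum

theorem IsEnsemble.countable_support {A : H →L[ℂ] H} {v : ι → H} (hA : IsEnsemble A v) :
    Countable (Function.support v) := by
  convert hA.summable.countable_support.to_subtype using 2
  ext i
  simp

/-- A square summable family has countable support. Countability is what `Measure.prod_sum` asks of
its second family. -/
theorem State.exists_countable_isEnsemble (ω : State H) :
    ∃ s : Set (basisIndex H), Countable s ∧ ∃ v : s → H, IsEnsemble ω.op v := by
  obtain ⟨v, hv⟩ := ω.exists_isEnsemble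
  exact ⟨_, hv.countable_support, _, hv.restrict_support⟩

variable {S : Type*} [MeasurableSpace S] {S' : Type*} [MeasurableSpace S']

theorem IsBornMeasure.eq_sum {E : POVM S H} {A : H →L[ℂ] H} {μ : ProbabilityMeasure S}
    (hμ : IsBornMeasure E.toFun A μ) {v : ι → H} (hA : IsEnsemble A v) :
    (μ : Measure S) = Measure.sum fun i => E.vectorMeasure (v i) := by
  ext X hX
  have h := hA.hasSum_trace (E.toFun X)
  rw [← hμ X hX] at h
  simp only [E.inner_eq_ofReal hX] at h
  rw [Complex.hasSum_ofReal] at h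
  rw [Measure.sum_apply _ hX, ← ENNReal.ofReal_toReal (measure_ne_top (μ : Measure S) X),
    ← h.tsum_eq, ENNReal.ofReal_tsum_of_nonneg (fun _ => measureReal_nonneg) h.summable]
  exact tsum_congr fun i => ofReal_measureReal

theorem IsBornMeasure.map {E : POVM S H} {A : H →L[ℂ] H} {μ : ProbabilityMeasure S}
    (hμ : IsBornMeasure E.toFun A μ) {f : S → S'} (hf : Measurable f) :
    IsBornMeasure (E.map f hf).toFun A (μ.map hf.aemeasurable) := fun X hX => by
  rw [ProbabilityMeasure.toMeasure_map, Measure.map_apply hf hX]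
  exact hμ _ (hf hX)

theorem map_diracProba {f : S → S'} (hf : Measurable f) (x : S) :
    (diracProba x).map hf.aemeasurable = diracProba (f x) :=
  Subtype.ext (Measure.map_dirac' hf x)

theorem prod_diracProba (x : S) (y : S') :
    (diracProba x).prod (diracProba y) = diracProba (x, y) :=
  Subtype.ext Measure.dirac_prod_dirac

end Born

/-! ### The law of the relative orientation and its limit. -/

section Orientation

variable {G : Type*} [Group G] [TopologicalSpace G] [IsTopologicalGroup G]
  [SecondCountableTopology G] [MeasurableSpace G] [BorelSpace G]
variable {H : Type*} [NormedAddCommGroup H] [InnerProductSpace ℂ H] [CompleteSpace H]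
variable {K : Type*} [NormedAddCommGroup K] [InnerProductSpace ℂ K] [CompleteSpace K]

/-- The map `(g, k) ↦ g⁻¹ h k`, through which the relative orientation is distributed when the
two orientations are `g` and `h k`. -/
def orientationMap (h : G) (p : G × G) : G := p.1⁻¹ * h * p.2

theorem continuous_orientationMap (h : G) : Continuous (orientationMap h) := by
  unfold orientationMap
  fun_prop

theorem inner_relativeOrientation (R₁ : Frame G G H) (R₂ : Frame G G K) (h : G) {X : Set G}
    (hX : MeasurableSet X) (φ : H) (ψ : K) :
    ⟪tmul φ (R₂.U.op h ψ), relativeOrientation R₁ R₂ X (tmul φ (R₂.U.op h ψ))⟫_ℂ =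
      ((((R₁.E.vectorMeasure φ).prod (R₂.E.vectorMeasure ψ)).map (orientationMap h)).real X :
        ℂ) := by
  have hf := (continuous_orientationMap h).measurable
  rw [relativeOrientation, isRelativization_relativization R₁ R₂.U (R₂.E.isPositive X hX)
    (R₂.E.isPositive_one_sub hX), Measure.real, Measure.map_apply hf hX,
    Measure.prod_apply (hf hX), ← integral_toReal
      (measurable_measure_prodMk_left (hf hX)).aemeasurable
      (Eventually.of_forall fun g => measure_lt_top _ _), ← integral_complex_ofReal]
  refine integral_congr_ae (Eventually.of_forall fun g => ?_)
  -- The section at `g` is the translate `h⁻¹gX`, to which covariance of `E₂` applies.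
  have hset : Prod.mk g ⁻¹' (orientationMap h ⁻¹' X) = (fun k => (h⁻¹ * g) • k) '' X := by
    ext k
    simp only [Set.mem_preimage, Set.mem_image, orientationMap, smul_eq_mul]
    constructor
    · exact fun hk => ⟨_, hk, by group⟩
    · rintro ⟨x, hx, rfl⟩
      convert hx using 1
      group
  have hmeas : MeasurableSet ((fun k => (h⁻¹ * g) • k) '' X) :=
    hset ▸ measurable_prodMk_left (hf hX)
  beta_reduce
  change _ = (((R₂.E.vectorMeasure ψ).real _ : ℝ) : ℂ)
  rw [hset, ← R₂.E.inner_eq_ofReal hmeas, R₂.covariant _ _ hX, UnitaryRep.inner_actObs,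
    UnitaryRep.inner_actObs]
  have hop : R₂.U.op g⁻¹ (R₂.U.op h ψ) = R₂.U.op (h⁻¹ * g)⁻¹ ψ := by
    rw [← ContinuousLinearMap.comp_apply, ← UnitaryRep.op_mul, mul_inv_rev, inv_inv]
  simp only [hop]

theorem isBornMeasure_relativeOrientation (R₁ : Frame G G H) (R₂ : Frame G G K) (h : G)
    {ω : State H} {ρ : State K} {μ ν : ProbabilityMeasure G}
    (hμ : IsBornMeasure R₁.E.toFun ω.op μ) (hν : IsBornMeasure R₂.E.toFun ρ.op ν) :
    IsBornMeasure (relativeOrientation R₁ R₂) (opTensor ω.op (R₂.U.actState h⁻¹ ρ.op))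
      ((μ.prod ν).map (continuous_orientationMap h).measurable.aemeasurable) := by
  intro X hX
  have hf := (continuous_orientationMap h).measurable
  obtain ⟨s, -, v, hv⟩ := ω.exists_countable_isEnsemble
  obtain ⟨t, ht, w, hw⟩ := ρ.exists_countable_isEnsemble
  -- The state action carries the adjoint on the left, so `h⁻¹` moves the vectors of the mixture by
  -- `U(h)`.
  have hact : R₂.U.actState h⁻¹ ρ.op = R₂.U.op h ∘L ρ.op ∘L (R₂.U.op h).adjoint := by
    rw [UnitaryRep.actState, UnitaryRep.adjoint_op, UnitaryRep.adjoint_op, inv_inv]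
  have hw' : IsEnsemble (R₂.U.actState h⁻¹ ρ.op) fun j => R₂.U.op h (w j) :=
    hact ▸ hw.conj _
  have htr := (isEnsemble_opTensor hv hw').hasSum_trace (relativeOrientation R₁ R₂ X)
  simp only [inner_relativeOrientation R₁ R₂ h hX] at htr
  have hsum : (((μ.prod ν).map hf.aemeasurable : ProbabilityMeasure G) : Measure G) =
      Measure.sum fun p : s × t => ((R₁.E.vectorMeasure (v p.1)).prod
        (R₂.E.vectorMeasure (w p.2))).map (orientationMap h) := by
    rw [ProbabilityMeasure.toMeasure_map, ProbabilityMeasure.toMeasure_prod, hμ.eq_sum hv,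
      hν.eq_sum hw, Measure.prod_sum, Measure.map_sum hf.aemeasurable]
  -- Finite total mass lets the `ENNReal` sum be compared with the complex trace series.
  have htop := measure_ne_top (((μ.prod ν).map hf.aemeasurable : ProbabilityMeasure G) :
    Measure G) X
  rw [hsum, Measure.sum_apply _ hX] at htop ⊢
  rw [ENNReal.tsum_toReal_eq (ENNReal.ne_top_of_tsum_ne_top htop)]
  exact (Complex.hasSum_ofReal.mpr (ENNReal.hasSum_toReal htop)).unique htr

theorem tendsto_map_orientationMap (h : G) {μ ν : ℕ → ProbabilityMeasure G}
    (hμ : Tendsto μ atTop (𝓝 (diracProba 1))) (hν : Tendsto ν atTop (𝓝 (diracProba 1))) :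
    Tendsto (fun p : ℕ × ℕ => ((μ p.1).prod (ν p.2)).map
      (continuous_orientationMap h).measurable.aemeasurable) (atTop ×ˢ atTop)
      (𝓝 (diracProba h)) := by
  have h1 := (ProbabilityMeasure.continuous_prod.tendsto
    (diracProba (1 : G), diracProba (1 : G))).comp ((hμ.comp tendsto_fst).prodMk_nhds (hν.comp tendsto_snd))
  have h2 := ProbabilityMeasure.tendsto_map_of_tendsto_of_continuous _ _ h1
    (continuous_orientationMap h)
  rw [prod_diracProba, map_diracProba (continuous_orientationMap h).measurable] at h2
  simpa [orientationMap] using h2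

/-- Born measures are pushed forward along `toGroup`, a continuous map taking the base point to `1`.
-/
theorem IsLocalizingSequence.exists_onGroup {S : Type*} [TopologicalSpace S] [MeasurableSpace S]
    [BorelSpace S] [MulAction G S] [ContinuousSMul G S] [MulAction.IsPretransitive G S]
    {R : Frame G S H} {x : S} {ω : ℕ → State H} (hω : IsLocalizingSequence R.E x ω)
    (hS : IsPrincipalSpace G S) :
    ∃ μ : ℕ → ProbabilityMeasure G,
      (∀ n, IsBornMeasure (R.onGroup hS x).E.toFun (ω n).op (μ n)) ∧
      Tendsto μ atTop (𝓝 (diracProba 1)) := by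
  obtain ⟨μ, hμ, hlim⟩ := hω
  have hc := (toGroup hS x).continuous
  refine ⟨fun n => (μ n).map hc.measurable.aemeasurable, fun n => (hμ n).map hc.measurable, ?_⟩
  have hx : toGroup hS x x = 1 := by
    rw [toGroup, Homeomorph.symm_apply_eq]
    exact (one_smul G x).symm
  have h := ProbabilityMeasure.tendsto_map_of_tendsto_of_continuous _ _ hlim hc
  rwa [map_diracProba hc.measurable, hx] at h

end Orientation

end QRF

theorem mainTheorem10
    {G : Type*} [Group G] [TopologicalSpace G] [IsTopologicalGroup G] [LocallyCompactSpace G]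
    [SecondCountableTopology G] [T2Space G] [MeasurableSpace G] [BorelSpace G]
    {S₁ : Type*} [TopologicalSpace S₁] [MeasurableSpace S₁] [BorelSpace S₁] [MulAction G S₁]
    [ContinuousSMul G S₁] [MulAction.IsPretransitive G S₁]
    {S₂ : Type*} [TopologicalSpace S₂] [MeasurableSpace S₂] [BorelSpace S₂] [MulAction G S₂]
    [ContinuousSMul G S₂] [MulAction.IsPretransitive G S₂]
    {H₁ : Type*} [NormedAddCommGroup H₁] [InnerProductSpace ℂ H₁] [CompleteSpace H₁]
    [TopologicalSpace.SeparableSpace H₁]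
    {H₂ : Type*} [NormedAddCommGroup H₂] [InnerProductSpace ℂ H₂] [CompleteSpace H₂]
    [TopologicalSpace.SeparableSpace H₂]
    (R₁ : QRF.Frame G S₁ H₁) (R₂ : QRF.Frame G S₂ H₂)
    (hS₁ : QRF.IsPrincipalSpace G S₁) (hS₂ : QRF.IsPrincipalSpace G S₂)
    (hE₁ : R₁.E.IsLocalizable) (hE₂ : R₂.E.IsLocalizable)
    (x₁ : S₁) (x₂ : S₂)
    (ω : ℕ → QRF.State H₁) (ρ : ℕ → QRF.State H₂)
    (hω : QRF.IsLocalizingSequence R₁.E x₁ ω) (hρ : QRF.IsLocalizingSequence R₂.E x₂ ρ)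
    (h : G) :
    ∃ μ : ℕ × ℕ → ProbabilityMeasure G,
      (∀ n m : ℕ, QRF.IsBornMeasure
        (QRF.relativeOrientation (R₁.onGroup hS₁ x₁) (R₂.onGroup hS₂ x₂))
        (QRF.opTensor (ω n).op (R₂.U.actState h⁻¹ (ρ m).op)) (μ (n, m))) ∧
      Tendsto μ (atTop ×ˢ atTop) (𝓝 (diracProba h)) := by
  obtain ⟨μ, hμ, hμ'⟩ := hω.exists_onGroup hS₁
  obtain ⟨ν, hν, hν'⟩ := hρ.exists_onGroup hS₂
  -- `(R₂.onGroup hS₂ x₂).U` is `R₂.U` by definition, so the states match.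
  exact ⟨fun p => ((μ p.1).prod (ν p.2)).map
    (QRF.continuous_orientationMap h).measurable.aemeasurable, fun n m => QRF.isBornMeasure_relativeOrientation (R₁.onGroup hS₁ x₁)
    (R₂.onGroup hS₂ x₂) h (hμ n) (hν m), QRF.tendsto_map_orientationMap h hμ' hν'⟩
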